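/- Let $F$ be a field of characteristic $0$ with algebraic closure $F^{\mathrm{alg}}$, and let $\Psi\colon (F,+)\to S^1$ and $\chi\colon (F^\times,\cdot)\to S^1$ be group homomorphisms to the complex unit circle. Write $\mathbb{T}^r=(S^1)^r$, $\Psi^{(r)}$ and $\chi^{(r)}$ for the coordinatewise maps. Algebraic sets are identified with their $F^{\mathrm{alg}}$-points; a curve $C\subseteq\mathbb{A}^n$ is a Zariski closed set of dimension one, and $C'$ denotes the set of points of $C$ with all coordinates nonzero; $C$ is zero-degenerate if $C'=\emptyset$; $C'(F)$ is the set of $F$-rational points of $C'$. A rational hyperplane over $F$ in $\mathbb{A}^n$ is a set $\{\sum_i s_ix_i=b\}$ with $0\neq s\in\mathbb{Z}^n$, $b\in F$; a multiplicative coset over $F$ in $\mathbb{G}_m^n$ is a set $\{\prod_i x_i^{t_i}=b\}$ with $0\neq t\in\mathbb{Z}^n$, $b\in F^\times$. **Axiom (4).** For every $n$, every Laurent polynomial $h=\sum_{i=1}^{e} c_i h_i\in\mathbb{Q}[Y_1^{\pm1},\dots,Y_n^{\pm1},Z_1^{\pm1},\dots,Z_n^{\pm1}]$ (with distinct monomials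 $h_i=\prod_jY_j^{s_{i,j}}\prod_jZ_j^{t_{i,j}}$ and $c_i\ne0$) that is real-valued on $\mathbb{T}^{2n}$ and has no constant term, and every absolutely irreducible, non zero-degenerate curve $C\subseteq\mathbb{A}^n$ defined over $F$: if for each $1\le i\le e$ at least one of - $(+)$ $(s_{i,j})_j\neq0$ and there is no $f\in F$ such that $\sum_j s_{i,j}x_j=f$ on $C$, - $(\times)$ $(t_{i,j})_j\neq0$ and there is no $f\in F^\times$ such that $\prod_jx_j^{t_{i,j}}=f$ on $C'$ holds, then $\sup\{h(\Psi^{(n)}(\bar x),\chi^{(n)}(\bar x)) : \bar x\in C'(F)\}\ge0$ (with $\sup\emptyset=-\infty$). **Property $(\star)$.** For all $n,k,l\ge0$, every absolutely irreducible, non zero-degenerate curve $C\subseteq\mathbb{A}^n$ defined over $F$, every $\alpha\colon\mathbb{A}^n\to\mathbb{A}^k$, $\alpha(\bar x)_j=\sum_i a_{j,i}x_i$ with $a_{j,i}\in\mathbb{Z}$, and every $\beta\colon\mathbb{G}_m^n\to\mathbb{G}_m^l$, $\beta(\bar x)_j=\prod_i x_i^{b_{j,i}}$ with $b_{j,i}\in\mathbb{Z}$: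 if $\alpha(C')$ is contained in no rational hyperplane over $F$ and $\beta(C')$ is contained in no multiplicative coset over $F$, then, with $\Delta(F)=\{(\alpha(\bar z),\beta(\bar z)):\bar z\in C'(F)\}$, the set $(\Psi^{(k)}\times\chi^{(l)})(\Delta(F))$ is dense in $\mathbb{T}^{k+l}$. **Lemma.** If $(F,\Psi,\chi)$ satisfies axiom (4), then it has property $(\star)$. If moreover $\mathrm{Gal}(F^{\mathrm{alg}}/F)\cong\hat{\mathbb{Z}}$ as topological groups, then $(F,\Psi,\chi)$ satisfies axiom (4) if and only if it has property $(\star)$. -/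

import Mathlib

namespace PFCharacters

noncomputable section

/-- `Gal(F) = Ẑ`: the absolute Galois group of `F` (with the Krull topology) is isomorphic, as a
topological group, to the profinite completion `Ẑ` of `ℤ`. -/
def GaloisGroupIsZHat (F : Type*) [Field F] : Prop :=
  Nonempty (Field.absoluteGaloisGroup F ≃ₜ*
    ProfiniteGrp.profiniteCompletion.obj (GrpCat.of (Multiplicative ℤ)))

/-- The integral linear transformation `𝔾ₐⁿ → 𝔾ₐᵏ` with integer coefficient matrix `A`:
`x ↦ (∑ᵢ A j i • xᵢ)ⱼ`. -/
def integralLinear {G : Type*} [AddCommGroup G] {n k : ℕ}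
    (A : Matrix (Fin k) (Fin n) ℤ) (x : Fin n → G) : Fin k → G :=
  fun j => ∑ i, A j i • x i

/-- The integral multiplicative transformation `𝔾ₘⁿ → 𝔾ₘˡ` with integer exponent matrix `B`:
`x ↦ (∏ᵢ xᵢ ^ B j i)ⱼ`. It is only ever applied to tuples of nonzero elements. -/
def integralMult {G : Type*} [DivisionCommMonoid G] {n l : ℕ}
    (B : Matrix (Fin l) (Fin n) ℤ) (x : Fin n → G) : Fin l → G :=
  fun j => ∏ i, x i ^ B j i

section Geometry

variable (F : Type*) [Field F]

/-- `C ⊆ 𝔸ⁿ` is an absolutely irreducible curve defined over `F`. The algebraic set `C` is given by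
its points over the algebraic closure `K` of `F`: it is the common zero locus of polynomials over
`F`, it is irreducible over `K` (its vanishing ideal in `K[X₁, …, Xₙ]` is prime), and its
coordinate ring has Krull dimension one. -/
structure IsAbsIrredCurve {n : ℕ} (C : Set (Fin n → AlgebraicClosure F)) : Prop where
  definedOver : ∃ I : Ideal (MvPolynomial (Fin n) F),
    C = MvPolynomial.zeroLocus (AlgebraicClosure F) I
  irreducible : (MvPolynomial.vanishingIdeal (AlgebraicClosure F) C).IsPrime
  dim_eq_one : ringKrullDim (MvPolynomial (Fin n) (AlgebraicClosure F) ⧸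
    MvPolynomial.vanishingIdeal (AlgebraicClosure F) C) = 1

variable {F}

/-- `C'`: the points of `C` all of whose coordinates are nonzero. -/
def offAxes {n : ℕ} (C : Set (Fin n → AlgebraicClosure F)) : Set (Fin n → AlgebraicClosure F) :=
  {x ∈ C | ∀ i, x i ≠ 0}

/-- `C` is zero-degenerate if it is contained in the union of the coordinate hyperplanes
`Xᵢ = 0`. -/
def ZeroDegenerate {n : ℕ} (C : Set (Fin n → AlgebraicClosure F)) : Prop :=
  C ⊆ {x | ∃ i, x i = 0}

/-- `C'(F)`: the `F`-rational points of `C'`, as tuples of units of `F`. -/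
def offAxesRationalPoints {n : ℕ} (C : Set (Fin n → AlgebraicClosure F)) : Set (Fin n → Fˣ) :=
  {u | (fun i => algebraMap F (AlgebraicClosure F) (u i : F)) ∈ C}

/-- The locus `∑ᵢ sᵢ xᵢ = b` in `𝔸ⁿ`, a rational hyperplane over `F` when `s ≠ 0`. -/
def additiveLocus {n : ℕ} (s : Fin n → ℤ) (b : F) : Set (Fin n → AlgebraicClosure F) :=
  {x | ∑ i, s i • x i = algebraMap F (AlgebraicClosure F) b}

/-- The locus `∏ᵢ xᵢ ^ tᵢ = b` in `𝔾ₘⁿ`, a multiplicative coset over `F` when `t ≠ 0`. -/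
def multiplicativeLocus {n : ℕ} (t : Fin n → ℤ) (b : Fˣ) : Set (Fin n → AlgebraicClosure F) :=
  {x | (∀ i, x i ≠ 0) ∧ ∏ i, x i ^ t i = algebraMap F (AlgebraicClosure F) (b : F)}

/-- `W` is contained in some rational hyperplane over `F`. -/
def InRationalHyperplane {n : ℕ} (W : Set (Fin n → AlgebraicClosure F)) : Prop :=
  ∃ s : Fin n → ℤ, s ≠ 0 ∧ ∃ b : F, W ⊆ additiveLocus s b

/-- `W` is contained in some multiplicative coset over `F`. -/
def InMultiplicativeCoset {n : ℕ} (W : Set (Fin n → AlgebraicClosure F)) : Prop :=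
  ∃ t : Fin n → ℤ, t ≠ 0 ∧ ∃ b : Fˣ, W ⊆ multiplicativeLocus t b

end Geometry

/-- Laurent polynomials over `ℚ` in the variables `Y₁, …, Yₙ, Z₁, …, Zₙ`: the group algebra of the
group `ℤⁿ × ℤⁿ` of exponent vectors `(s, t)` of the monomials `∏ⱼ Yⱼ ^ sⱼ * ∏ⱼ Zⱼ ^ tⱼ`. -/
abbrev Laurent (n : ℕ) : Type := AddMonoidAlgebra ℚ ((Fin n → ℤ) × (Fin n → ℤ))

/-- The value of a Laurent polynomial at a point `(y, z)` of the torus `𝕋²ⁿ = 𝕋ⁿ × 𝕋ⁿ`. -/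
def Laurent.evalTorus {n : ℕ} (h : Laurent n) (y z : Fin n → Circle) : ℂ :=
  h.coeff.sum fun m c => (c : ℂ) * (((∏ j, y j ^ m.1 j) * (∏ j, z j ^ m.2 j) : Circle) : ℂ)

/-- The Laurent polynomial `h` takes real values on the torus `𝕋²ⁿ`. -/
def Laurent.RealValued {n : ℕ} (h : Laurent n) : Prop :=
  ∀ y z : Fin n → Circle, (h.evalTorus y z).im = 0

section Characters

variable {F : Type*} [Field F]

/-- Axiom (4) of the theory, for an additive character `Ψ` and a multiplicative character `χ`.
The supremum is taken in the extended reals, so the supremum of the empty set is `-∞`. -/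
def AxiomFour (Ψ : AddChar F Circle) (χ : Fˣ →* Circle) : Prop :=
  ∀ (n : ℕ) (h : Laurent n), h.RealValued → h.coeff 0 = 0 →
    ∀ C : Set (Fin n → AlgebraicClosure F), IsAbsIrredCurve F C → ¬ ZeroDegenerate C →
      (∀ m ∈ h.coeff.support,
        (m.1 ≠ 0 ∧ ¬ ∃ f : F, C ⊆ additiveLocus m.1 f) ∨
        (m.2 ≠ 0 ∧ ¬ ∃ f : Fˣ, offAxes C ⊆ multiplicativeLocus m.2 f)) →
      (0 : EReal) ≤ ⨆ u ∈ offAxesRationalPoints C,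
        (((h.evalTorus (fun i => Ψ (u i : F)) (fun i => χ (u i))).re : ℝ) : EReal)

/-- `Δ(F)`: the diagonal of `F`-points `(α(z), β(z))` with `z ∈ C'(F)`, where `α`, `β` are the
integral linear and multiplicative transformations with matrices `A`, `B`. -/
def diagonal {n k l : ℕ} (C : Set (Fin n → AlgebraicClosure F))
    (A : Matrix (Fin k) (Fin n) ℤ) (B : Matrix (Fin l) (Fin n) ℤ) :
    Set ((Fin k → F) × (Fin l → Fˣ)) :=
  (fun u : Fin n → Fˣ => (integralLinear A (fun i => (u i : F)), integralMult B u)) ''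
    offAxesRationalPoints C

/-- Property (⋆), for an additive character `Ψ` and a multiplicative character `χ`. The torus
`𝕋ᵏ⁺ˡ` is written as `𝕋ᵏ × 𝕋ˡ`. -/
def PropertyStar (Ψ : AddChar F Circle) (χ : Fˣ →* Circle) : Prop :=
  ∀ (n k l : ℕ) (C : Set (Fin n → AlgebraicClosure F))
    (A : Matrix (Fin k) (Fin n) ℤ) (B : Matrix (Fin l) (Fin n) ℤ),
    IsAbsIrredCurve F C → ¬ ZeroDegenerate C →
    ¬ InRationalHyperplane (integralLinear A '' offAxes C) →
    ¬ InMultiplicativeCoset (integralMult B '' offAxes C) →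
    Dense ((fun p : (Fin k → F) × (Fin l → Fˣ) =>
        ((fun j => Ψ (p.1 j), fun j => χ (p.2 j)) : (Fin k → Circle) × (Fin l → Circle))) ''
      diagonal C A B)

end Characters

end

end PFCharacters

/-! Both directions rest on Fourier analysis on the compact torus: a trigonometric polynomial
without constant term has Haar mean zero, so its real part cannot be uniformly negative
(`exists_le_re_trigEval`); but by Stone–Weierstrass it can be uniformly negative off any given
nonempty open set (`exists_trigEval_re_neg_off`).

Axiom (4) implies (⋆): if the image misses an open `U`, take such a polynomial for `U`. Its
coefficients are complex, while the axiom allows only rational ones. By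
`AxiomFour.exists_addChar_im_ne_zero` some `ω = Ψ a` is not real, and every coefficient is close to
some `q + r * ω` with `q`, `r` rational. Replacing `C` by `{a} × C` turns `ω` into the value of a
monomial in the new coordinate, so the axiom applies to a rational cosine polynomial and contradicts
negativity off `U`.

(⋆) implies axiom (4): the exponent vectors whose sum, or product, is constant on `C'` with value in
`F` form saturated subgroups of `ℤⁿ`. Bases of complements give `α` and `β` to which (⋆) applies. On
`C'(F)` the Laurent polynomial becomes a trigonometric polynomial in the coordinates of `α` and `β`;
the condition on its monomials says that no constant term arises. A negative supremum would spread
by density to the whole torus, against mean zero. -/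

namespace PFCharacters

noncomputable section

open MeasureTheory

/-- Exponent vectors of monomials on `𝕋ᵏ × 𝕋ˡ`. -/
abbrev Exponent (k l : ℕ) : Type := (Fin k → ℤ) × (Fin l → ℤ)

/-- The torus `𝕋ᵏ × 𝕋ˡ`. -/
abbrev Torus (k l : ℕ) : Type := (Fin k → Circle) × (Fin l → Circle)

/-- The character of `𝕋ᵏ × 𝕋ˡ` with exponent vector `m`. -/
def monomialChar {k l : ℕ} (m : Exponent k l) (p : Torus k l) : Circle :=
  (∏ j, p.1 j ^ m.1 j) * ∏ j, p.2 j ^ m.2 j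

/-! ### Trigonometric polynomials on the torus -/

section MonomialChar

variable {k l : ℕ}

theorem monomialChar_zero (p : Torus k l) : monomialChar 0 p = 1 := by
  simp [monomialChar]

theorem monomialChar_add (m m' : Exponent k l) (p : Torus k l) :
    monomialChar (m + m') p = monomialChar m p * monomialChar m' p := by
  simp only [monomialChar, Prod.fst_add, Prod.snd_add, Pi.add_apply, zpow_add,
    Finset.prod_mul_distrib]
  exact mul_mul_mul_comm _ _ _ _

theorem monomialChar_neg (m : Exponent k l) (p : Torus k l) :
    monomialChar (-m) p = (monomialChar m p)⁻¹ := by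
  rw [eq_inv_iff_mul_eq_one, ← monomialChar_add, neg_add_cancel, monomialChar_zero]

theorem monomialChar_mul (m : Exponent k l) (p q : Torus k l) :
    monomialChar m (p * q) = monomialChar m p * monomialChar m q := by
  simp only [monomialChar, Prod.fst_mul, Prod.snd_mul, Pi.mul_apply, mul_zpow,
    Finset.prod_mul_distrib]
  exact mul_mul_mul_comm _ _ _ _

theorem continuous_monomialChar (m : Exponent k l) : Continuous (monomialChar m) := by
  unfold monomialChar
  fun_prop

theorem exists_circle_zpow_ne_one {a : ℤ} (ha : a ≠ 0) : ∃ z : Circle, z ^ a ≠ 1 := by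
  refine ⟨Circle.exp (Real.pi / a), ?_⟩
  rw [← Circle.exp_intCast_mul, mul_div_cancel₀ _ (by exact_mod_cast ha)]
  exact Circle.exp_pi_ne_one

theorem exists_monomialChar_ne_one {m : Exponent k l} (hm : m ≠ 0) :
    ∃ p, monomialChar m p ≠ 1 := by
  classical
  by_cases h : m.1 = 0
  · have h2 : m.2 ≠ 0 := fun h2 => hm (Prod.ext h h2)
    obtain ⟨j, hj⟩ := Function.ne_iff.1 h2
    obtain ⟨z, hz⟩ := exists_circle_zpow_ne_one hj
    refine ⟨(1, Pi.mulSingle j z), ?_⟩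
    simpa [monomialChar, Pi.mulSingle_apply, ite_pow, Finset.prod_ite_eq'] using hz
  · obtain ⟨j, hj⟩ := Function.ne_iff.1 h
    obtain ⟨z, hz⟩ := exists_circle_zpow_ne_one hj
    refine ⟨(Pi.mulSingle j z, 1), ?_⟩
    simpa [monomialChar, Pi.mulSingle_apply, ite_pow, Finset.prod_ite_eq'] using hz

/-- The characters of the torus, as a homomorphism from exponent vectors to continuous functions. -/
def monomialHom (k l : ℕ) : Multiplicative (Exponent k l) →* C(Torus k l, ℂ) where
  toFun m := ⟨fun p => (monomialChar m.toAdd p : ℂ),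
    continuous_subtype_val.comp (continuous_monomialChar _)⟩
  map_one' := by ext p; simp [monomialChar_zero]
  map_mul' m m' := by ext p; simp [monomialChar_add]

/-- Complex trigonometric polynomials, as continuous functions on the torus. -/
def trigEval (k l : ℕ) : AddMonoidAlgebra ℂ (Exponent k l) →ₐ[ℂ] C(Torus k l, ℂ) :=
  AddMonoidAlgebra.lift ℂ _ _ (monomialHom k l)

theorem trigEval_single (m : Exponent k l) (c : ℂ) (p : Torus k l) :
    trigEval k l (AddMonoidAlgebra.single m c) p = c * monomialChar m p := by
  simp [trigEval, monomialHom]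

theorem trigEval_apply (x : AddMonoidAlgebra ℂ (Exponent k l)) (p : Torus k l) :
    trigEval k l x p = ∑ m ∈ x.coeff.support, x.coeff m * monomialChar m p := by
  simp [trigEval, AddMonoidAlgebra.lift_apply, Finsupp.sum, monomialHom]

/-- Translating by a point `q` where the character is not `1` multiplies the integral by that value,
yet leaves it unchanged. -/
theorem integral_monomialChar [MeasurableSpace (Torus k l)] [BorelSpace (Torus k l)]
    (μ : Measure (Torus k l)) [μ.IsMulLeftInvariant] {m : Exponent k l} (hm : m ≠ 0) :
    ∫ p, (monomialChar m p : ℂ) ∂μ = 0 := by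
  obtain ⟨q, hq⟩ := exists_monomialChar_ne_one hm
  have h := integral_mul_left_eq_self (μ := μ) (fun p => (monomialChar m p : ℂ)) q
  simp only [monomialChar_mul, Circle.coe_mul, integral_const_mul] at h
  have h1 : (monomialChar m q : ℂ) - 1 ≠ 0 := sub_ne_zero.2 fun e => hq (Circle.coe_eq_one.1 e)
  have h2 : ((monomialChar m q : ℂ) - 1) * ∫ p, (monomialChar m p : ℂ) ∂μ = 0 := by
    rw [sub_mul, h, one_mul, sub_self]
  exact (mul_eq_zero.1 h2).resolve_left h1

theorem integral_trigEval [MeasurableSpace (Torus k l)] [BorelSpace (Torus k l)]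
    (μ : Measure (Torus k l)) [μ.IsMulLeftInvariant] [IsProbabilityMeasure μ]
    (x : AddMonoidAlgebra ℂ (Exponent k l)) :
    ∫ p, trigEval k l x p ∂μ = x.coeff 0 := by
  have hint : ∀ f : C(Torus k l, ℂ), Integrable f μ := fun f =>
    f.continuous.integrable_of_hasCompactSupport (HasCompactSupport.of_compactSpace _)
  induction x using AddMonoidAlgebra.induction_linear with
  | zero => simp
  | add x y hx hy =>
    simp only [map_add, ContinuousMap.add_apply, AddMonoidAlgebra.coeff_add, Finsupp.add_apply]
    rw [integral_add (hint _) (hint _), hx, hy]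
  | single m c =>
    simp only [trigEval_single, integral_const_mul, AddMonoidAlgebra.coeff_single]
    by_cases hm : m = 0
    · subst hm; simp [monomialChar_zero]
    · rw [integral_monomialChar μ hm, Finsupp.single_eq_of_ne (Ne.symm hm), mul_zero]

theorem exists_probability_haar (k l : ℕ) [MeasurableSpace (Torus k l)]
    [BorelSpace (Torus k l)] :
    ∃ μ : Measure (Torus k l), μ.IsHaarMeasure ∧ IsProbabilityMeasure μ := by
  refine ⟨Measure.haarMeasure ⊤, inferInstance, ⟨?_⟩⟩
  simpa using Measure.haarMeasure_self (K₀ := (⊤ : TopologicalSpace.PositiveCompacts (Torus k l)))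

/-- A trigonometric polynomial without constant term has no uniformly negative real part. -/
theorem exists_le_re_trigEval (x : AddMonoidAlgebra ℂ (Exponent k l)) (hx : x.coeff 0 = 0)
    {ε : ℝ} (hε : 0 < ε) : ∃ p, -ε < (trigEval k l x p).re := by
  by_contra! h
  borelize (Torus k l)
  obtain ⟨μ, hμ, hμ'⟩ := exists_probability_haar k l
  have hint : Integrable (trigEval k l x) μ :=
    (trigEval k l x).continuous.integrable_of_hasCompactSupport
      (HasCompactSupport.of_compactSpace _)
  have h1 : ∫ p, (trigEval k l x p).re ∂μ = 0 := by
    have : ∫ p, (trigEval k l x p).re ∂μ = (∫ p, trigEval k l x p ∂μ).re :=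
      integral_re (𝕜 := ℂ) hint
    rw [this, integral_trigEval, hx, Complex.zero_re]
  have h2 : ∫ p, (trigEval k l x p).re ∂μ ≤ ∫ _, -ε ∂μ :=
    integral_mono hint.re (integrable_const _) h
  simp at h2
  linarith

theorem trigEval_star_mem (x : AddMonoidAlgebra ℂ (Exponent k l)) :
    star (trigEval k l x) ∈ (trigEval k l).range := by
  induction x using AddMonoidAlgebra.induction_linear with
  | zero => simp
  | add x y hx hy => rw [map_add, star_add]; exact add_mem hx hy
  | single m c =>
    refine ⟨AddMonoidAlgebra.single (-m) (star c), ?_⟩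
    ext p
    simp [trigEval_single, monomialChar_neg, ← Circle.coe_inv_eq_conj]

/-- Trigonometric polynomials, as a star subalgebra of the continuous functions. -/
def trigStarSubalgebra (k l : ℕ) : StarSubalgebra ℂ C(Torus k l, ℂ) where
  toSubalgebra := (trigEval k l).range
  star_mem' := by
    rintro _ ⟨x, rfl⟩
    exact trigEval_star_mem x

theorem trigStarSubalgebra_separatesPoints (k l : ℕ) :
    (trigStarSubalgebra k l).SeparatesPoints := by
  classical
  intro p q hpq
  have key : ∀ m : Exponent k l, monomialChar m p ≠ monomialChar m q →
      ∃ f ∈ (fun f : C(Torus k l, ℂ) => (f : Torus k l → ℂ)) ''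
        (trigStarSubalgebra k l : Set C(Torus k l, ℂ)), f p ≠ f q := by
    intro m hm
    refine ⟨_, ⟨trigEval k l (AddMonoidAlgebra.single m 1), ⟨_, rfl⟩, rfl⟩, ?_⟩
    simpa [trigEval_single, Circle.coe_inj] using hm
  by_cases h : p.1 = q.1
  · have h2 : p.2 ≠ q.2 := fun h2 => hpq (Prod.ext h h2)
    obtain ⟨j, hj⟩ := Function.ne_iff.1 h2
    refine key (0, Pi.single j 1) ?_
    simpa [monomialChar, Pi.single_apply, pow_ite, Finset.prod_ite_eq'] using hj
  · obtain ⟨j, hj⟩ := Function.ne_iff.1 h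
    refine key (Pi.single j 1, 0) ?_
    simpa [monomialChar, Pi.single_apply, pow_ite, Finset.prod_ite_eq'] using hj

theorem exists_trigEval_close (f : C(Torus k l, ℂ)) {ε : ℝ} (hε : 0 < ε) :
    ∃ x, ∀ p, ‖trigEval k l x p - f p‖ < ε := by
  have h := ContinuousMap.starSubalgebra_topologicalClosure_eq_top_of_separatesPoints
    (trigStarSubalgebra k l) (trigStarSubalgebra_separatesPoints k l)
  have hf : f ∈ closure (trigStarSubalgebra k l : Set C(Torus k l, ℂ)) := by
    rw [← StarSubalgebra.topologicalClosure_coe, h]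
    trivial
  obtain ⟨_, ⟨x, rfl⟩, hx⟩ := Metric.mem_closure_iff.1 hf ε hε
  refine ⟨x, fun p => ?_⟩
  rw [dist_comm, dist_eq_norm] at hx
  exact ((trigEval k l x - f).norm_coe_le_norm p).trans_lt hx

/-- For every nonempty open subset `U` of the torus there is a trigonometric polynomial without
constant term whose real part is uniformly negative off `U`. -/
theorem exists_trigEval_re_neg_off {U : Set (Torus k l)} (hU : IsOpen U) (hne : U.Nonempty) :
    ∃ x : AddMonoidAlgebra ℂ (Exponent k l), x.coeff 0 = 0 ∧
      ∃ ε > 0, ∀ p ∉ U, (trigEval k l x p).re ≤ -ε := by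
  borelize (Torus k l)
  obtain ⟨μ, hμ, hμ'⟩ := exists_probability_haar k l
  obtain ⟨p₀, hp₀⟩ := hne
  obtain ⟨f, hf0, hf1, hf⟩ := exists_continuous_zero_one_of_isClosed hU.isClosed_compl
    (isClosed_singleton (x := p₀)) (by simpa using hp₀)
  have hfint : Integrable f μ :=
    f.continuous.integrable_of_hasCompactSupport (HasCompactSupport.of_compactSpace _)
  have hpos : 0 < ∫ p, f p ∂μ :=
    f.continuous.integral_pos_of_hasCompactSupport_nonneg_nonzero
      (HasCompactSupport.of_compactSpace _) (fun p => (hf p).1)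
      (x := p₀) (by rw [hf1 rfl]; exact one_ne_zero)
  set c := ∫ p, f p ∂μ with hc
  let g : C(Torus k l, ℂ) := ⟨fun p => (f p : ℂ), by fun_prop⟩
  -- With error `c / 4` the constant term has real part at least `3c/4`, while off `U`, where `f =
  -- 0`, the real part is below `c / 4`. Removing the constant term leaves at most `-c / 2` there.
  obtain ⟨x, hx⟩ := exists_trigEval_close g (ε := c / 4) (by positivity)
  have hclose : ∀ p, |(trigEval k l x p).re - f p| < c / 4 := fun p => by
    have := (Complex.abs_re_le_norm _).trans_lt (hx p)
    simpa [g] using this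
  have hint : Integrable (trigEval k l x) μ :=
    (trigEval k l x).continuous.integrable_of_hasCompactSupport
      (HasCompactSupport.of_compactSpace _)
  have h1 : ∫ p, (trigEval k l x p).re ∂μ = (x.coeff 0).re := by
    have : ∫ p, (trigEval k l x p).re ∂μ = (∫ p, trigEval k l x p ∂μ).re :=
      integral_re (𝕜 := ℂ) hint
    rw [this, integral_trigEval]
  have h2 : c - c / 4 ≤ (x.coeff 0).re := by
    rw [← h1]
    calc c - c / 4 = ∫ p, (f p - c / 4) ∂μ := by
          rw [integral_sub hfint (integrable_const _)]; simp [hc]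
      _ ≤ _ := integral_mono (hfint.sub (integrable_const _)) hint.re fun p => by
          have := (abs_lt.1 (hclose p)).1
          change f p - c / 4 ≤ (trigEval k l x p).re
          linarith
  refine ⟨x - AddMonoidAlgebra.single 0 (x.coeff 0), by simp, c / 2, by positivity, ?_⟩
  intro p hp
  have h3 := (abs_lt.1 (hclose p)).2
  rw [hf0 hp] at h3
  simp only [map_sub, ContinuousMap.sub_apply, trigEval_single, monomialChar_zero,
    Circle.coe_one, mul_one, Complex.sub_re]
  simp only [Pi.zero_apply] at h3
  linarith

end MonomialChar

/-! ### Curves with an added constant coordinate; integral transformations -/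

section Geometry

variable {F : Type*} [Field F] {n : ℕ}

open MvPolynomial

/-- The curve `{a} × C ⊆ 𝔸ⁿ⁺¹`. -/
def consCurve (a : F) (C : Set (Fin n → AlgebraicClosure F)) :
    Set (Fin (n + 1) → AlgebraicClosure F) :=
  {x | x 0 = algebraMap F (AlgebraicClosure F) a ∧ Fin.tail x ∈ C}

theorem cons_mem_consCurve {a : F} {C : Set (Fin n → AlgebraicClosure F)}
    {x : Fin n → AlgebraicClosure F} (hx : x ∈ C) :
    (Fin.cons (algebraMap F (AlgebraicClosure F) a) x : Fin (n + 1) → AlgebraicClosure F) ∈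
      consCurve a C :=
  ⟨rfl, by simpa using hx⟩

theorem exists_zeroLocus_eq_consCurve (a : F) (I : Ideal (MvPolynomial (Fin n) F)) :
    ∃ J : Ideal (MvPolynomial (Fin (n + 1)) F),
      consCurve a (zeroLocus (AlgebraicClosure F) I) = zeroLocus (AlgebraicClosure F) J := by
  refine ⟨Ideal.span (insert (X 0 - MvPolynomial.C a) (rename Fin.succ '' (I : Set _))), ?_⟩
  ext x
  rw [zeroLocus_span]
  simp only [consCurve, Set.mem_ofPred_eq, Set.forall_mem_insert, Set.forall_mem_image, map_sub,
    aeval_X, algHom_C, sub_eq_zero, mem_zeroLocus_iff, aeval_rename]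
  rfl

/-- Substituting the constant `a` for the first variable. -/
def substHead (a : F) (n : ℕ) : MvPolynomial (Fin (n + 1)) (AlgebraicClosure F) →ₐ[AlgebraicClosure F]
    MvPolynomial (Fin n) (AlgebraicClosure F) :=
  aeval (Fin.cons (MvPolynomial.C (algebraMap F (AlgebraicClosure F) a)) X)

theorem aeval_substHead (a : F) (x : Fin n → AlgebraicClosure F)
    (p : MvPolynomial (Fin (n + 1)) (AlgebraicClosure F)) :
    aeval x (substHead a n p) =
      aeval (Fin.cons (algebraMap F (AlgebraicClosure F) a) x : Fin (n + 1) → AlgebraicClosure F) p := by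
  rw [substHead, ← AlgHom.comp_apply]
  congr 1
  ext i
  refine Fin.cases ?_ (fun j => ?_) i <;> simp

theorem substHead_surjective (a : F) (n : ℕ) : Function.Surjective (substHead a n) := by
  intro p
  refine ⟨rename Fin.succ p, ?_⟩
  rw [substHead, aeval_rename]
  exact aeval_X_left_apply p

theorem vanishingIdeal_consCurve (a : F) (C : Set (Fin n → AlgebraicClosure F)) :
    vanishingIdeal (AlgebraicClosure F) (consCurve a C) =
      (vanishingIdeal (AlgebraicClosure F) C).comap (substHead a n) := by
  ext p
  rw [Ideal.mem_comap]
  simp only [mem_vanishingIdeal_iff, aeval_substHead]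
  constructor
  · intro h x hx
    exact h _ (cons_mem_consCurve hx)
  · rintro h x ⟨h0, hx⟩
    have := h _ hx
    rwa [← h0, Fin.cons_self_tail] at this

/-- Substituting `a` for the first variable induces an isomorphism of coordinate rings, so primality
and dimension carry over. -/
theorem IsAbsIrredCurve.consCurve {C : Set (Fin n → AlgebraicClosure F)}
    (hC : IsAbsIrredCurve F C) (a : F) : IsAbsIrredCurve F (consCurve a C) where
  definedOver := by
    obtain ⟨I, rfl⟩ := hC.definedOver
    exact exists_zeroLocus_eq_consCurve a I
  irreducible := by
    have := hC.irreducible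
    rw [vanishingIdeal_consCurve]
    exact Ideal.comap_isPrime _ _
  dim_eq_one := by
    rw [← hC.dim_eq_one]
    set I := vanishingIdeal (AlgebraicClosure F) C
    have hsurj : Function.Surjective ((Ideal.Quotient.mk I).comp (substHead a n).toRingHom) :=
      Ideal.Quotient.mk_surjective.comp (substHead_surjective a n)
    have hker : vanishingIdeal (AlgebraicClosure F) (PFCharacters.consCurve a C) =
        RingHom.ker ((Ideal.Quotient.mk I).comp (substHead a n).toRingHom) := by
      rw [vanishingIdeal_consCurve, ← RingHom.comap_ker, Ideal.mk_ker]
      rfl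
    exact ringKrullDim_eq_of_ringEquiv
      ((Ideal.quotEquivOfEq hker).trans (RingHom.quotientKerEquivOfSurjective hsurj))

theorem consCurve_not_zeroDegenerate {C : Set (Fin n → AlgebraicClosure F)}
    (hC : ¬ ZeroDegenerate C) {a : F} (ha : a ≠ 0) : ¬ ZeroDegenerate (consCurve a C) := by
  intro h
  refine hC fun x hx => ?_
  obtain ⟨i, hi⟩ := h (cons_mem_consCurve (a := a) hx)
  revert hi
  refine Fin.cases ?_ (fun j => ?_) i
  · simp [ha]
  · intro hj
    exact ⟨j, by simpa using hj⟩

theorem cons_mem_offAxes_consCurve {C : Set (Fin n → AlgebraicClosure F)} {a : F} (ha : a ≠ 0)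
    {x : Fin n → AlgebraicClosure F} (hx : x ∈ offAxes C) :
    (Fin.cons (algebraMap F (AlgebraicClosure F) a) x : Fin (n + 1) → AlgebraicClosure F) ∈
      offAxes (consCurve a C) :=
  ⟨cons_mem_consCurve hx.1, fun i => Fin.cases (by simpa using ha) (fun j => by simpa using hx.2 j) i⟩

/-- The affine line is an absolutely irreducible curve. -/
theorem isAbsIrredCurve_univ :
    IsAbsIrredCurve F (Set.univ : Set (Fin 1 → AlgebraicClosure F)) := by
  have hI : vanishingIdeal (AlgebraicClosure F) (Set.univ : Set (Fin 1 → AlgebraicClosure F)) = ⊥ := by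
    refine (eq_bot_iff).2 fun p hp => MvPolynomial.funext fun x => ?_
    simpa [aeval_eq_eval] using (mem_vanishingIdeal_iff.1 hp) x trivial
  refine ⟨⟨⊥, by rw [zeroLocus_bot]; rfl⟩, ?_, ?_⟩
  · rw [hI]; exact Ideal.isPrime_bot
  · rw [hI, ringKrullDim_eq_of_ringEquiv (RingEquiv.quotientBot _)]
    simp [MvPolynomial.ringKrullDim_of_isNoetherianRing]

theorem univ_not_zeroDegenerate :
    ¬ ZeroDegenerate (Set.univ : Set (Fin n → AlgebraicClosure F)) := by
  intro h
  obtain ⟨i, hi⟩ := h (Set.mem_univ 1)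
  simp at hi

theorem integralLinear_dotProduct {G : Type*} [AddCommGroup G] {k : ℕ}
    (A : Matrix (Fin k) (Fin n) ℤ) (s : Fin k → ℤ) (x : Fin n → G) :
    ∑ j, s j • integralLinear A x j = ∑ i, (Matrix.vecMul s A) i • x i := by
  simp only [integralLinear, Matrix.vecMul, dotProduct, Finset.smul_sum, Finset.sum_smul, smul_smul]
  exact Finset.sum_comm

/-- Additivity of exponents is a hypothesis because the lemma serves both units of `F` and nonzero
elements of the algebraic closure, where it fails at zero. -/
theorem prod_integralMult {G : Type*} [DivisionCommMonoid G] {l : ℕ}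
    (B : Matrix (Fin l) (Fin n) ℤ) (t : Fin l → ℤ) (x : Fin n → G)
    (hx : ∀ i, ∀ a b : ℤ, x i ^ (a + b) = x i ^ a * x i ^ b) :
    ∏ j, integralMult B x j ^ t j = ∏ i, x i ^ (Matrix.vecMul t B) i := by
  have hs : ∀ i, ∀ f : Fin l → ℤ, ∀ S : Finset (Fin l),
      x i ^ (∑ j ∈ S, f j) = ∏ j ∈ S, x i ^ f j := by
    classical
    intro i f S
    induction S using Finset.induction_on with
    | empty => simp
    | insert j S hj ih => rw [Finset.sum_insert hj, Finset.prod_insert hj, hx, ih]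
  simp only [integralMult, Matrix.vecMul, dotProduct, hs]
  rw [Finset.prod_comm]
  simp only [← zpow_mul, mul_comm, ← Finset.prod_zpow]

end Geometry

/-! ### Nonconstant monomials on a curve -/

section Nonconstancy

variable {F : Type*} [Field F] {n : ℕ}

theorem additiveLocus_neg (s : Fin n → ℤ) (f : F) :
    additiveLocus (-s) f = additiveLocus s (-f) := by
  ext x
  simp [additiveLocus, neg_eq_iff_eq_neg]

theorem multiplicativeLocus_neg (t : Fin n → ℤ) (f : Fˣ) :
    multiplicativeLocus (-t) f = multiplicativeLocus t f⁻¹ := by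
  ext x
  simp [multiplicativeLocus, inv_eq_iff_eq_inv]

/-- The additive or the multiplicative part of the monomial with exponent vector `m` is not
constant, with value in `F`, on `C`. -/
def Nonconstant (C : Set (Fin n → AlgebraicClosure F)) (m : Exponent n n) : Prop :=
  (¬ ∃ f : F, C ⊆ additiveLocus m.1 f) ∨ ¬ ∃ f : Fˣ, offAxes C ⊆ multiplicativeLocus m.2 f

theorem Nonconstant.neg {C : Set (Fin n → AlgebraicClosure F)} {m : Exponent n n}
    (h : Nonconstant C m) : Nonconstant C (-m) := by
  refine h.imp (fun h => ?_) fun h => ?_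
  · rintro ⟨f, hf⟩
    exact h ⟨-f, by rwa [← additiveLocus_neg]⟩
  · rintro ⟨f, hf⟩
    exact h ⟨f⁻¹, by rwa [← multiplicativeLocus_neg]⟩

/-- The zero vector always gives a constant, so the nonvanishing clause of axiom (4) is automatic;
hence its absence from `Nonconstant`. -/
theorem ne_zero_of_not_subset_additiveLocus {C : Set (Fin n → AlgebraicClosure F)}
    {s : Fin n → ℤ} (h : ¬ ∃ f : F, C ⊆ additiveLocus s f) : s ≠ 0 := by
  rintro rfl
  exact h ⟨0, fun x _ => by simp [additiveLocus]⟩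

theorem ne_zero_of_not_subset_multiplicativeLocus {C : Set (Fin n → AlgebraicClosure F)}
    {t : Fin n → ℤ} (h : ¬ ∃ f : Fˣ, offAxes C ⊆ multiplicativeLocus t f) : t ≠ 0 := by
  rintro rfl
  exact h ⟨1, fun x hx => ⟨hx.2, by simp⟩⟩

theorem offAxes_subset_additiveLocus_of_consCurve {C : Set (Fin n → AlgebraicClosure F)} {a f : F}
    {i : ℤ} {s : Fin n → ℤ}
    (h : consCurve a C ⊆ additiveLocus (Fin.cons i s : Fin (n + 1) → ℤ) f) :
    offAxes C ⊆ additiveLocus s (f - i • a) := by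
  intro x hx
  have := h (cons_mem_consCurve hx.1)
  simp only [additiveLocus, Set.mem_ofPred_eq, Fin.sum_univ_succ, Fin.cons_zero,
    Fin.cons_succ] at this ⊢
  rw [map_sub, map_zsmul, ← this, add_sub_cancel_left]

theorem offAxes_subset_multiplicativeLocus_of_consCurve {C : Set (Fin n → AlgebraicClosure F)}
    {a : F} (ha : a ≠ 0) {f : Fˣ} {t : Fin n → ℤ}
    (h : offAxes (consCurve a C) ⊆ multiplicativeLocus (Fin.cons 0 t : Fin (n + 1) → ℤ) f) :
    offAxes C ⊆ multiplicativeLocus t f := by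
  intro x hx
  have := (h (cons_mem_offAxes_consCurve ha hx)).2
  simp only [Fin.prod_univ_succ, Fin.cons_zero, Fin.cons_succ, zpow_zero, one_mul] at this
  exact ⟨hx.2, this⟩

/-- The exponent vector on `𝔸ⁿ⁺¹` obtained by pulling back `m` along the integral transformations
given by `A` and `B`, with exponent `i` of the first additive coordinate. -/
def pullbackExponent {k l : ℕ} (A : Matrix (Fin k) (Fin n) ℤ) (B : Matrix (Fin l) (Fin n) ℤ)
    (i : ℤ) (m : Exponent k l) : Exponent (n + 1) (n + 1) :=
  (Fin.cons i (Matrix.vecMul m.1 A), Fin.cons 0 (Matrix.vecMul m.2 B))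

/-- The new coordinate is constantly `a`, so the exponent `i` only shifts an additive relation by `i
• a`. What remains is a relation on `α(C')` or `β(C')`. -/
theorem nonconstant_pullbackExponent {k l : ℕ} {C : Set (Fin n → AlgebraicClosure F)}
    {A : Matrix (Fin k) (Fin n) ℤ} {B : Matrix (Fin l) (Fin n) ℤ}
    (hA : ¬ InRationalHyperplane (integralLinear A '' offAxes C))
    (hB : ¬ InMultiplicativeCoset (integralMult B '' offAxes C))
    {a : F} (ha : a ≠ 0) (i : ℤ) {m : Exponent k l} (hm : m ≠ 0) :
    Nonconstant (consCurve a C) (pullbackExponent A B i m) := by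
  by_cases h1 : m.1 = 0
  · have h2 : m.2 ≠ 0 := fun h2 => hm (Prod.ext h1 h2)
    refine Or.inr ?_
    rintro ⟨f, hf⟩
    refine hB ⟨m.2, h2, f, ?_⟩
    rintro _ ⟨x, hx, rfl⟩
    have := (offAxes_subset_multiplicativeLocus_of_consCurve ha hf hx).2
    refine ⟨fun j => Finset.prod_ne_zero_iff.2 fun i _ => zpow_ne_zero _ (hx.2 i), ?_⟩
    rwa [prod_integralMult _ _ _ fun i a b => zpow_add₀ (hx.2 i) a b]
  · refine Or.inl ?_
    rintro ⟨f, hf⟩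
    refine hA ⟨m.1, h1, f - i • a, ?_⟩
    rintro _ ⟨x, hx, rfl⟩
    have := offAxes_subset_additiveLocus_of_consCurve hf hx
    rw [additiveLocus, Set.mem_ofPred_eq, integralLinear_dotProduct]
    exact this

end Nonconstancy

/-! ### Rational cosine polynomials -/

section Laurent

variable {n : ℕ}

theorem evalTorus_eq_sum (h : Laurent n) (y z : Fin n → Circle) :
    h.evalTorus y z = h.coeff.sum fun m c => (c : ℂ) * (monomialChar m (y, z) : ℂ) := rfl

theorem evalTorus_add (h h' : Laurent n) (y z : Fin n → Circle) :
    (h + h').evalTorus y z = h.evalTorus y z + h'.evalTorus y z := by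
  simp only [evalTorus_eq_sum, AddMonoidAlgebra.coeff_add]
  exact Finsupp.sum_add_index' (by simp) (by intros; push_cast; ring)

theorem evalTorus_single (m : Exponent n n) (c : ℚ) (y z : Fin n → Circle) :
    Laurent.evalTorus (AddMonoidAlgebra.single m c) y z = c * monomialChar m (y, z) := by
  rw [evalTorus_eq_sum, AddMonoidAlgebra.coeff_single, Finsupp.sum_single_index (by simp)]

theorem evalTorus_sum {ι : Type*} (S : Finset ι) (h : ι → Laurent n) (y z : Fin n → Circle) :
    Laurent.evalTorus (∑ i ∈ S, h i) y z = ∑ i ∈ S, (h i).evalTorus y z := by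
  classical
  induction S using Finset.induction_on with
  | empty => simp [evalTorus_eq_sum]
  | insert i S hi ih => rw [Finset.sum_insert hi, Finset.sum_insert hi, evalTorus_add, ih]

/-- The Laurent polynomial `c * (M + M⁻¹) / 2`, where `M` is the monomial with exponent `m`. -/
def cosine (m : Exponent n n) (c : ℚ) : Laurent n :=
  AddMonoidAlgebra.single m (c / 2) + AddMonoidAlgebra.single (-m) (c / 2)

theorem evalTorus_cosine (m : Exponent n n) (c : ℚ) (y z : Fin n → Circle) :
    (cosine m c).evalTorus y z = ((c * (monomialChar m (y, z) : ℂ).re : ℝ) : ℂ) := by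
  rw [cosine, evalTorus_add, evalTorus_single, evalTorus_single, monomialChar_neg,
    Circle.coe_inv_eq_conj, ← mul_add, Complex.add_conj]
  push_cast
  ring

theorem mem_support_cosine {m m' : Exponent n n} {c : ℚ} (h : m' ∈ (cosine m c).coeff.support) :
    m' = m ∨ m' = -m := by
  classical
  rw [cosine, AddMonoidAlgebra.coeff_add] at h
  refine (Finset.mem_union.1 (Finsupp.support_add h)).imp (fun h => ?_) fun h => ?_
  · exact Finset.mem_singleton.1 (Finsupp.support_single_subset h)
  · exact Finset.mem_singleton.1 (Finsupp.support_single_subset h)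

/-- Axiom (4) for rational cosine polynomials. -/
theorem AxiomFour.exists_sum_cosine_gt {F : Type*} [Field F] {Ψ : AddChar F Circle}
    {χ : Fˣ →* Circle} (hax : AxiomFour Ψ χ) {C : Set (Fin n → AlgebraicClosure F)}
    (hC : IsAbsIrredCurve F C) (hC0 : ¬ ZeroDegenerate C) {ι : Type*} (S : Finset ι)
    (e : ι → Exponent n n) (q : ι → ℚ) (he : ∀ i ∈ S, Nonconstant C (e i)) {ε : ℝ} (hε : 0 < ε) :
    ∃ u ∈ offAxesRationalPoints C, -ε < ∑ i ∈ S, (q i : ℝ) *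
      (monomialChar (e i) (fun j => Ψ (u j : F), fun j => χ (u j)) : ℂ).re := by
  classical
  set h : Laurent n := ∑ i ∈ S, cosine (e i) (q i) with hh
  have heval : ∀ y z, h.evalTorus y z =
      ((∑ i ∈ S, (q i : ℝ) * (monomialChar (e i) (y, z) : ℂ).re : ℝ) : ℂ) := by
    intro y z
    rw [hh, evalTorus_sum, Complex.ofReal_sum]
    exact Finset.sum_congr rfl fun i _ => evalTorus_cosine _ _ _ _
  have hsupp : ∀ m ∈ h.coeff.support, Nonconstant C m := by
    intro m hm
    rw [hh, AddMonoidAlgebra.coeff_sum] at hm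
    obtain ⟨i, hi, hm⟩ := Finset.mem_biUnion.1 (Finsupp.support_finsetSum hm)
    rcases mem_support_cosine hm with rfl | rfl
    · exact he i hi
    · exact (he i hi).neg
  have hcond : ∀ m ∈ h.coeff.support, (m.1 ≠ 0 ∧ ¬ ∃ f : F, C ⊆ additiveLocus m.1 f) ∨
        (m.2 ≠ 0 ∧ ¬ ∃ f : Fˣ, offAxes C ⊆ multiplicativeLocus m.2 f) := fun m hm =>
    (hsupp m hm).imp (fun h => ⟨ne_zero_of_not_subset_additiveLocus h, h⟩)
      fun h => ⟨ne_zero_of_not_subset_multiplicativeLocus h, h⟩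
  -- The zero exponent satisfies neither alternative of `hcond`, so it is not in the support.
  have h0 : h.coeff 0 = 0 := by
    by_contra h0
    rcases hcond 0 (Finsupp.mem_support_iff.2 h0) with h | h <;> exact h.1 rfl
  have hsup := hax n h (fun y z => by rw [heval, Complex.ofReal_im]) h0 C hC hC0 hcond
  have hlt : ((-ε : ℝ) : EReal) < 0 := by exact_mod_cast neg_lt_zero.2 hε
  obtain ⟨u, hu⟩ := lt_iSup_iff.1 (hlt.trans_le hsup)
  obtain ⟨huC, hu⟩ := lt_iSup_iff.1 hu
  refine ⟨u, huC, ?_⟩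
  rw [heval, Complex.ofReal_re] at hu
  exact_mod_cast hu

end Laurent

/-! ### From axiom (4) to property (⋆) -/

section AxiomFourToStar

variable {F : Type*} [Field F] {Ψ : AddChar F Circle} {χ : Fˣ →* Circle}

/-- `1` and `ω` form a real basis of `ℂ`; approximate both coordinates by rationals. -/
theorem exists_rat_combination_close {ω : ℂ} (hω : ω.im ≠ 0) (c : ℂ) {δ : ℝ} (hδ : 0 < δ) :
    ∃ q r : ℚ, ‖c - (q + r * ω)‖ < δ := by
  have hω0 : 0 < ‖ω‖ := norm_pos_iff.2 fun h => hω (by simp [h])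
  obtain ⟨r, hr⟩ := (Rat.denseRange_cast (𝕜 := ℝ)).exists_dist_lt (c.im / ω.im)
    (ε := δ / (2 * ‖ω‖)) (by positivity)
  obtain ⟨q, hq⟩ := (Rat.denseRange_cast (𝕜 := ℝ)).exists_dist_lt (c.re - c.im / ω.im * ω.re)
    (ε := δ / 2) (by positivity)
  refine ⟨q, r, ?_⟩
  have hc : c = ((c.re - c.im / ω.im * ω.re : ℝ) : ℂ) + ((c.im / ω.im : ℝ) : ℂ) * ω := by
    apply Complex.ext
    · simp
    · simp [hω]
  set c₁ := c.re - c.im / ω.im * ω.re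
  set c₂ := c.im / ω.im
  have : c - (q + r * ω) = ((c₁ - q : ℝ) : ℂ) + ((c₂ - r : ℝ) : ℂ) * ω := by
    rw [hc]; push_cast; ring
  rw [this]
  rw [Real.dist_eq] at hq hr
  calc ‖((c₁ - q : ℝ) : ℂ) + ((c₂ - r : ℝ) : ℂ) * ω‖
      ≤ ‖((c₁ - q : ℝ) : ℂ)‖ + ‖((c₂ - r : ℝ) : ℂ) * ω‖ := norm_add_le _ _
    _ = |c₁ - q| + |c₂ - r| * ‖ω‖ := by
        rw [norm_mul, Complex.norm_real, Complex.norm_real, Real.norm_eq_abs, Real.norm_eq_abs]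
    _ < δ / 2 + δ / (2 * ‖ω‖) * ‖ω‖ :=
        add_lt_add hq (mul_lt_mul_of_pos_right hr hω0)
    _ = δ := by field_simp; ring

theorem AxiomFour.exists_addChar_im_ne_zero [CharZero F] (hax : AxiomFour Ψ χ) :
    ∃ a : F, a ≠ 0 ∧ (Ψ a : ℂ).im ≠ 0 := by
  have hnc : Nonconstant (Set.univ : Set (Fin 1 → AlgebraicClosure F))
      ((1, 0) : Exponent 1 1) := by
    refine Or.inl ?_
    rintro ⟨f, hf⟩
    have := hf (Set.mem_univ fun _ => algebraMap F (AlgebraicClosure F) f + 1)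
    simp [additiveLocus] at this
  -- The axiom for `-(Y + Y⁻¹) / 2` on the affine line gives a nonzero `u` with `Re Ψ(u) < 1/2`.
  obtain ⟨u, -, hu⟩ := hax.exists_sum_cosine_gt isAbsIrredCurve_univ univ_not_zeroDegenerate
    {()} (fun _ => (1, 0)) (fun _ => -1) (fun _ _ => hnc) (ε := 1 / 2) (by norm_num)
  simp [monomialChar] at hu
  by_cases him : (Ψ (u 0 : F) : ℂ).im = 0
  -- A real `Ψ(u/2)` would be `±1`, forcing its square `Ψ(u)` to be `1`.
  · refine ⟨(u 0 : F) / 2, by simp, fun him2 => ?_⟩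
    have hsq : (Ψ (u 0 : F) : ℂ) = (Ψ ((u 0 : F) / 2) : ℂ) * Ψ ((u 0 : F) / 2) := by
      rw [← Circle.coe_mul, ← AddChar.map_add_eq_mul, add_halves]
    have hnorm := Circle.normSq_coe (Ψ ((u 0 : F) / 2))
    rw [Complex.normSq_apply, him2] at hnorm
    rw [hsq, Complex.mul_re, him2] at hu
    linarith
  · exact ⟨u 0, by simp, him⟩

theorem addChar_map_sum {ι : Type*} (S : Finset ι) (x : ι → F) :
    Ψ (∑ i ∈ S, x i) = ∏ i ∈ S, Ψ (x i) :=
  map_prod Ψ.toMonoidHom (fun i => Multiplicative.ofAdd (x i)) S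

/-- The factor `Ψ (u 0) ^ i` is what simulates a coefficient `ω ^ i`, once `u 0 = a`. -/
theorem monomialChar_pullbackExponent {n k l : ℕ} (A : Matrix (Fin k) (Fin n) ℤ)
    (B : Matrix (Fin l) (Fin n) ℤ) (i : ℤ) (m : Exponent k l) (u : Fin (n + 1) → Fˣ) :
    monomialChar (pullbackExponent A B i m) (fun j => Ψ (u j : F), fun j => χ (u j)) =
      Ψ (u 0) ^ i * monomialChar m (fun j => Ψ (integralLinear A (fun i => (u i.succ : F)) j),
        fun j => χ (integralMult B (fun i => u i.succ) j)) := by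
  simp only [monomialChar, pullbackExponent, Fin.prod_univ_succ, Fin.cons_zero, Fin.cons_succ,
    zpow_zero, one_mul, mul_assoc]
  congr 2
  · simp only [← AddChar.map_zsmul_eq_zpow, ← addChar_map_sum, integralLinear_dotProduct]
  · simp only [← map_zpow, ← map_prod]
    rw [prod_integralMult _ _ _ fun i a b => zpow_add _ a b]

theorem AxiomFour.propertyStar [CharZero F] (hax : AxiomFour Ψ χ) : PropertyStar Ψ χ := by
  intro n k l C A B hC hC0 hA hB
  obtain ⟨a, ha, hω⟩ := hax.exists_addChar_im_ne_zero
  set ω : ℂ := (Ψ a : ℂ) with hωdef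
  by_contra hd
  obtain ⟨U, hU, hUne, hUdisj⟩ : ∃ U : Set (Torus k l), IsOpen U ∧ U.Nonempty ∧
      ∀ u ∈ offAxesRationalPoints C, ((fun j => Ψ (integralLinear A (fun i => (u i : F)) j),
        fun j => χ (integralMult B u j)) : Torus k l) ∉ U := by
    rw [dense_iff_inter_open] at hd
    push Not at hd
    obtain ⟨U, hU, hUne, h⟩ := hd
    refine ⟨U, hU, hUne, fun u hu hmem => ?_⟩
    exact (Set.eq_empty_iff_forall_notMem.1 h) _ ⟨hmem, _, ⟨u, hu, rfl⟩, rfl⟩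
  obtain ⟨x, hx0, ε, hε, hx⟩ := exists_trigEval_re_neg_off hU hUne
  set S := x.coeff.support with hS
  have hSne : ∀ m ∈ S, m ≠ 0 := by
    rintro m hm rfl
    exact Finsupp.mem_support_iff.1 hm hx0
  -- The total approximation error is then at most `ε / 2`; the `+ 1` covers empty `S`.
  set δ : ℝ := ε / (2 * (S.card + 1)) with hδdef
  have hδ : 0 < δ := by positivity
  choose q r hqr using fun m => exists_rat_combination_close hω (x.coeff m) hδ
  -- Each `m` contributes two cosines: index `0` carries `q m`, index `1` carries `r m` together
  -- with the factor `ω`.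
  obtain ⟨u, ⟨hu0, huC⟩, hu⟩ := hax.exists_sum_cosine_gt (hC.consCurve a)
    (consCurve_not_zeroDegenerate hC0 ha) (S ×ˢ ({0, 1} : Finset ℤ))
    (fun mi => pullbackExponent A B mi.2 mi.1) (fun mi => if mi.2 = 0 then q mi.1 else r mi.1)
    (fun mi hmi => nonconstant_pullbackExponent hA hB ha _ (hSne _ (Finset.mem_product.1 hmi).1))
    (half_pos hε)
  have hua : (u 0 : F) = a := (algebraMap F (AlgebraicClosure F)).injective hu0
  set p : Torus k l := (fun j => Ψ (integralLinear A (fun i => (u i.succ : F)) j),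
        fun j => χ (integralMult B (fun i => u i.succ) j)) with hp
  have hpU : p ∉ U := hUdisj (fun i => u i.succ) huC
  have hxp := hx p hpU
  rw [trigEval_apply, Complex.re_sum] at hxp
  rw [Finset.sum_product] at hu
  have hterm : ∀ m ∈ S, (∑ i ∈ ({0, 1} : Finset ℤ), (((if i = 0 then q m else r m : ℚ) : ℝ) *
      (monomialChar (pullbackExponent A B i m)
        (fun j => Ψ (u j : F), fun j => χ (u j)) : ℂ).re)) ≤
      (x.coeff m * monomialChar m p).re + δ := by
    intro m _
    rw [Finset.sum_pair zero_ne_one]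
    simp only [monomialChar_pullbackExponent, hua, ← hp, if_true, if_neg one_ne_zero,
      zpow_zero, one_mul, zpow_one, Circle.coe_mul]
    rw [← hωdef]
    have h1 : (q m : ℝ) * (monomialChar m p : ℂ).re + r m * (ω * monomialChar m p).re =
        (((q m : ℂ) + r m * ω) * monomialChar m p).re := by
      rw [add_mul, Complex.add_re, mul_assoc, ← Complex.ofReal_ratCast, ← Complex.ofReal_ratCast,
        Complex.re_ofReal_mul, Complex.re_ofReal_mul]
    rw [h1, ← sub_le_iff_le_add', ← Complex.sub_re, ← sub_mul]
    refine (Complex.re_le_norm _).trans ?_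
    rw [norm_mul, Circle.norm_coe, mul_one, norm_sub_rev]
    exact (hqr m).le
  have hsum := Finset.sum_le_sum hterm
  rw [Finset.sum_add_distrib, Finset.sum_const, nsmul_eq_mul] at hsum
  have hcard : (S.card : ℝ) * δ ≤ ε / 2 := by
    rw [hδdef, mul_div_assoc', div_le_iff₀ (by positivity)]
    nlinarith
  -- The cosine sum exceeds `-ε / 2`, yet is at most `-ε + ε / 2`.
  linarith

end AxiomFourToStar

/-! ### From property (⋆) to axiom (4) -/

section StarToAxiomFour

variable {F : Type*} [Field F] {n : ℕ}

open MvPolynomial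

/-- The product of the `p i` and all coordinates vanishes on `C`. The ideal is prime and, as `C` is
not zero-degenerate, omits the product of the coordinates. -/
theorem exists_mem_vanishingIdeal_of_prod_eq_zero {C : Set (Fin n → AlgebraicClosure F)}
    (hC : (vanishingIdeal (AlgebraicClosure F) C).IsPrime) (hC0 : ¬ ZeroDegenerate C)
    {ι : Type*} (S : Finset ι) (p : ι → MvPolynomial (Fin n) (AlgebraicClosure F))
    (hp : ∀ x ∈ offAxes C, ∃ i ∈ S, eval x (p i) = 0) :
    ∃ i ∈ S, ∀ x ∈ C, eval x (p i) = 0 := by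
  have hX : (∏ i, X i) * ∏ i ∈ S, p i ∈ vanishingIdeal (AlgebraicClosure F) C := by
    rw [mem_vanishingIdeal_iff]
    intro x hx
    rw [aeval_eq_eval, map_mul, map_prod, map_prod, mul_eq_zero, Finset.prod_eq_zero_iff,
      Finset.prod_eq_zero_iff]
    by_cases h : ∀ i, x i ≠ 0
    · exact Or.inr (hp x ⟨hx, h⟩)
    · push Not at h
      obtain ⟨i, hi⟩ := h
      exact Or.inl ⟨i, Finset.mem_univ i, by simpa using hi⟩
  rcases hC.mem_or_mem hX with h | h
  · refine absurd (fun x hx => ?_) hC0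
    have := mem_vanishingIdeal_iff.1 h x hx
    rw [aeval_eq_eval, map_prod, Finset.prod_eq_zero_iff] at this
    obtain ⟨i, -, hi⟩ := this
    exact ⟨i, by simpa using hi⟩
  · obtain ⟨i, hi, h⟩ := hC.prod_mem_iff.1 h
    exact ⟨i, hi, fun x hx => mem_vanishingIdeal_iff.1 h x hx⟩

theorem subset_additiveLocus_of_offAxes_subset {C : Set (Fin n → AlgebraicClosure F)}
    (hC : (vanishingIdeal (AlgebraicClosure F) C).IsPrime) (hC0 : ¬ ZeroDegenerate C)
    {s : Fin n → ℤ} {f : F} (h : offAxes C ⊆ additiveLocus s f) : C ⊆ additiveLocus s f := by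
  have heval : ∀ x : Fin n → AlgebraicClosure F,
      eval x (∑ i, s i • X i - MvPolynomial.C (algebraMap F (AlgebraicClosure F) f)) = 0 ↔
        x ∈ additiveLocus s f := by
    intro x
    simp [additiveLocus, sub_eq_zero]
  obtain ⟨-, -, hp⟩ := exists_mem_vanishingIdeal_of_prod_eq_zero hC hC0 {()}
    (fun _ => ∑ i, s i • X i - MvPolynomial.C (algebraMap F (AlgebraicClosure F) f))
    fun x hx => ⟨(), by simp, (heval x).2 (h hx)⟩
  exact fun x hx => (heval x).1 (hp x hx)

/-- The integer vectors `s` such that `∑ᵢ sᵢ xᵢ` is constant on `C'`, with value in `F`. -/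
def additiveRelations (C : Set (Fin n → AlgebraicClosure F)) : AddSubgroup (Fin n → ℤ) where
  carrier := {s | ∃ f : F, offAxes C ⊆ additiveLocus s f}
  zero_mem' := ⟨0, fun x _ => by simp [additiveLocus]⟩
  add_mem' := by
    rintro s s' ⟨f, hf⟩ ⟨f', hf'⟩
    refine ⟨f + f', fun x hx => ?_⟩
    have h := hf hx
    have h' := hf' hx
    simp only [additiveLocus, Set.mem_ofPred_eq] at h h' ⊢
    simp [add_smul, Finset.sum_add_distrib, ← h, ← h']
  neg_mem' := by
    rintro s ⟨f, hf⟩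
    exact ⟨-f, by rwa [additiveLocus_neg, neg_neg]⟩

/-- The integer vectors `t` such that `∏ᵢ xᵢ ^ tᵢ` is constant on `C'`, with value in `F`. -/
def multiplicativeRelations (C : Set (Fin n → AlgebraicClosure F)) :
    AddSubgroup (Fin n → ℤ) where
  carrier := {t | ∃ f : Fˣ, offAxes C ⊆ multiplicativeLocus t f}
  zero_mem' := ⟨1, fun x hx => ⟨hx.2, by simp⟩⟩
  add_mem' := by
    rintro t t' ⟨f, hf⟩ ⟨f', hf'⟩
    refine ⟨f * f', fun x hx => ⟨hx.2, ?_⟩⟩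
    simp only [Pi.add_apply, zpow_add₀ (hx.2 _), Finset.prod_mul_distrib, (hf hx).2, (hf' hx).2,
      Units.val_mul, map_mul]
  neg_mem' := by
    rintro t ⟨f, hf⟩
    exact ⟨f⁻¹, by rwa [multiplicativeLocus_neg, inv_inv]⟩

theorem additiveRelations_saturated [CharZero F] (C : Set (Fin n → AlgebraicClosure F)) {N : ℤ}
    (hN : N ≠ 0) {s : Fin n → ℤ} (h : N • s ∈ additiveRelations C) : s ∈ additiveRelations C := by
  obtain ⟨f, hf⟩ := h
  have : CharZero (AlgebraicClosure F) :=
    charZero_of_injective_algebraMap (algebraMap F (AlgebraicClosure F)).injective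
  refine ⟨f / N, fun x hx => ?_⟩
  have := hf hx
  simp only [additiveLocus, Set.mem_ofPred_eq, Pi.smul_apply, smul_assoc,
    ← Finset.smul_sum] at this ⊢
  rw [map_div₀, map_intCast, eq_div_iff (by exact_mod_cast hN), ← this, zsmul_eq_mul, mul_comm]

/-- Relative to its value at `u`, the monomial takes values in the finitely many `N`-th roots of
unity, so irreducibility makes it constant. -/
theorem prod_zpow_eq_of_zpow_eq {C : Set (Fin n → AlgebraicClosure F)}
    (hC : (vanishingIdeal (AlgebraicClosure F) C).IsPrime) {t : Fin n → ℤ} {N : ℤ} (hN : N ≠ 0)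
    {u : Fin n → AlgebraicClosure F} (hu : u ∈ offAxes C)
    (h : ∀ x ∈ offAxes C, (∏ i, x i ^ t i) ^ N = (∏ i, u i ^ t i) ^ N)
    {x : Fin n → AlgebraicClosure F} (hx : x ∈ offAxes C) :
    ∏ i, x i ^ t i = ∏ i, u i ^ t i := by
  have hC0 : ¬ ZeroDegenerate C := fun hz => by
    obtain ⟨i, hi⟩ := hz hu.1
    exact hu.2 i hi
  set w := ∏ i, u i ^ t i with hw
  have hw0 : w ≠ 0 := Finset.prod_ne_zero_iff.2 fun i _ => zpow_ne_zero _ (hu.2 i)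
  -- The equation `∏ i, x i ^ t i = ζ * w`, cleared of negative exponents.
  let p : AlgebraicClosure F → MvPolynomial (Fin n) (AlgebraicClosure F) := fun ζ =>
    ∏ i, X i ^ (t i).toNat - MvPolynomial.C (ζ * w) * ∏ i, X i ^ (-t i).toNat
  have heval : ∀ ζ, ∀ y ∈ offAxes C, eval y (p ζ) = 0 ↔ ∏ i, y i ^ t i = ζ * w := by
    intro ζ y hy
    have h0 : ∏ i, y i ^ (-t i).toNat ≠ 0 :=
      Finset.prod_ne_zero_iff.2 fun i _ => pow_ne_zero _ (hy.2 i)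
    have h1 : ∏ i, y i ^ t i = (∏ i, y i ^ (t i).toNat) / ∏ i, y i ^ (-t i).toNat := by
      rw [← Finset.prod_div_distrib]
      refine Finset.prod_congr rfl fun i _ => ?_
      rw [← zpow_natCast, ← zpow_natCast, ← zpow_sub₀ (hy.2 i), Int.toNat_sub_toNat_neg]
    rw [h1, div_eq_iff h0]
    simp [p, sub_eq_zero]
  have hN' : 0 < N.natAbs := Int.natAbs_pos.2 hN
  obtain ⟨ζ, -, hζ⟩ := exists_mem_vanishingIdeal_of_prod_eq_zero hC hC0
    (Polynomial.nthRootsFinset N.natAbs (1 : AlgebraicClosure F)) p fun y hy => by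
      refine ⟨(∏ i, y i ^ t i) / w, ?_, (heval _ y hy).2 (div_mul_cancel₀ _ hw0).symm⟩
      have hz : ((∏ i, y i ^ t i) / w) ^ N = 1 := by
        rw [div_zpow, h y hy, div_self (zpow_ne_zero _ hw0)]
      rw [Polynomial.mem_nthRootsFinset hN']
      rcases Int.natAbs_eq N with hN | hN <;> rw [hN] at hz
      · rwa [zpow_natCast] at hz
      · rwa [zpow_neg, zpow_natCast, inv_eq_one] at hz
  have h1 := (heval ζ u hu).1 (hζ u hu.1)
  have h2 := (heval ζ x hx).1 (hζ x hx.1)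
  rw [h2, ← h1]

theorem algebraMap_mem_offAxes {C : Set (Fin n → AlgebraicClosure F)} {u : Fin n → Fˣ}
    (hu : u ∈ offAxesRationalPoints C) :
    (fun i => algebraMap F (AlgebraicClosure F) (u i : F)) ∈ offAxes C :=
  ⟨hu, fun i => by simp⟩

theorem algebraMap_prod_zpow (t : Fin n → ℤ) (u : Fin n → Fˣ) :
    algebraMap F (AlgebraicClosure F) ((∏ i, u i ^ t i : Fˣ) : F) =
      ∏ i, algebraMap F (AlgebraicClosure F) (u i : F) ^ t i := by
  simp [Units.coe_prod, map_prod, map_zpow₀]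

/-- The constant is an `N`-th root of `f`, which could lie outside `F`; a rational point of `C'`
shows that it lies in `F`. -/
theorem multiplicativeRelations_saturated {C : Set (Fin n → AlgebraicClosure F)}
    (hC : (vanishingIdeal (AlgebraicClosure F) C).IsPrime)
    (hne : (offAxesRationalPoints C).Nonempty) {N : ℤ} (hN : N ≠ 0) {t : Fin n → ℤ}
    (h : N • t ∈ multiplicativeRelations C) : t ∈ multiplicativeRelations C := by
  obtain ⟨f, hf⟩ := h
  obtain ⟨u, hu⟩ := hne
  have hf' : ∀ x ∈ offAxes C,
      (∏ i, x i ^ t i) ^ N = algebraMap F (AlgebraicClosure F) (f : F) := by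
    intro x hx
    rw [← (hf hx).2, ← Finset.prod_zpow]
    simp [zpow_mul']
  refine ⟨∏ i, u i ^ t i, fun x hx => ⟨hx.2, ?_⟩⟩
  rw [algebraMap_prod_zpow]
  exact prod_zpow_eq_of_zpow_eq hC hN (algebraMap_mem_offAxes hu)
    (fun y hy => by rw [hf' y hy, hf' _ (algebraMap_mem_offAxes hu)]) hx

/-- A saturated subgroup of `ℤⁿ` has a complement; the rows of `A` are a basis of one. -/
theorem exists_complement_of_saturated (L : AddSubgroup (Fin n → ℤ))
    (hL : ∀ N : ℤ, N ≠ 0 → ∀ s, N • s ∈ L → s ∈ L) :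
    ∃ (k : ℕ) (A : Matrix (Fin k) (Fin n) ℤ),
      (∀ s, ∃ a, s - Matrix.vecMul a A ∈ L) ∧ ∀ a, Matrix.vecMul a A ∈ L → a = 0 := by
  let M := AddSubgroup.toIntSubmodule L
  -- Saturation makes the finitely generated quotient torsion-free, hence free; the rows of `A` lift
  -- a basis.
  have : Module.IsTorsionFree ℤ ((Fin n → ℤ) ⧸ M) := by
    refine Module.IsTorsionFree.of_smul_eq_zero fun N y hy => ?_
    obtain ⟨s, rfl⟩ := M.mkQ_surjective y
    rw [← map_smul] at hy
    refine or_iff_not_imp_left.2 fun hN => (Submodule.Quotient.mk_eq_zero M).2 ?_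
    exact hL N hN s ((Submodule.Quotient.mk_eq_zero M).1 hy)
  let b := Module.finBasis ℤ ((Fin n → ℤ) ⧸ M)
  choose A hA using fun j => M.mkQ_surjective (b j)
  have hmk : ∀ a : Fin _ → ℤ, M.mkQ (Matrix.vecMul a (Matrix.of A)) = ∑ j, a j • b j := by
    intro a
    rw [Matrix.vecMul_eq_sum, map_sum]
    exact Finset.sum_congr rfl fun j _ => by
      rw [map_zsmul]; exact congrArg _ (hA j)
  refine ⟨_, Matrix.of A, fun s => ⟨b.repr (M.mkQ s), ?_⟩, fun a ha => ?_⟩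
  · have h : M.mkQ (s - Matrix.vecMul (b.repr (M.mkQ s)) (Matrix.of A)) = 0 := by
      rw [map_sub, hmk, b.sum_repr, sub_self]
    exact (Submodule.Quotient.mk_eq_zero M).1 h
  · have h : M.mkQ (Matrix.vecMul a (Matrix.of A)) = 0 :=
      (Submodule.Quotient.mk_eq_zero M).2 ha
    rw [hmk] at h
    funext j
    exact Fintype.linearIndependent_iff.1 b.linearIndependent a h j

theorem PropertyStar.axiomFour [CharZero F] {Ψ : AddChar F Circle} {χ : Fˣ →* Circle}
    (hstar : PropertyStar Ψ χ) : AxiomFour Ψ χ := by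
  intro n h _ _ C hC hC0 hcond
  have hne : (offAxesRationalPoints C).Nonempty := by
    -- For `k = l = 0` the torus is a point, and density says that `C'(F)` is nonempty.
    have hd := hstar n 0 0 C 0 0 hC hC0
      (by rintro ⟨s, hs, -⟩; exact hs (Subsingleton.elim _ _))
      (by rintro ⟨s, hs, -⟩; exact hs (Subsingleton.elim _ _))
    exact hd.nonempty.of_image.of_image
  obtain ⟨k, A, hA, hA'⟩ := exists_complement_of_saturated (additiveRelations C)
    fun N hN s => additiveRelations_saturated C hN
  obtain ⟨l, B, hB, hB'⟩ := exists_complement_of_saturated (multiplicativeRelations C)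
    fun N hN t => multiplicativeRelations_saturated hC.irreducible hne hN
  have hdense := hstar n k l C A B hC hC0
    (by
      rintro ⟨s, hs, f, hf⟩
      refine hs (hA' s ⟨f, fun x hx => ?_⟩)
      have := hf ⟨x, hx, rfl⟩
      rwa [additiveLocus, Set.mem_ofPred_eq, integralLinear_dotProduct] at this)
    (by
      rintro ⟨t, ht, f, hf⟩
      refine ht (hB' t ⟨f, fun x hx => ⟨hx.2, ?_⟩⟩)
      have := (hf ⟨x, hx, rfl⟩).2
      rwa [prod_integralMult _ _ _ fun i a b => zpow_add₀ (hx.2 i) a b] at this)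
  choose a f hf using hA
  choose b g hg using hB
  -- On `C'(F)` each monomial is one in the coordinates of `α` and `β`, times the unit constant `Ψ
  -- (f m.1) * χ (g m.2)` coming from the relations.
  let x : AddMonoidAlgebra ℂ (Exponent k l) := ∑ m ∈ h.coeff.support,
    AddMonoidAlgebra.single (a m.1, b m.2) ((h.coeff m : ℂ) * (Ψ (f m.1) * χ (g m.2) : Circle))
  have hx0 : x.coeff 0 = 0 := by
    simp only [x, AddMonoidAlgebra.coeff_sum, Finsupp.finsetSum_apply,
      AddMonoidAlgebra.coeff_single]
    refine Finset.sum_eq_zero fun m hm => Finsupp.single_eq_of_ne ?_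
    -- A zero exponent here would make both parts of `m` constant on the curve, against `hcond`.
    intro he
    have h1 : a m.1 = 0 := (congrArg Prod.fst he).symm
    have h2 : b m.2 = 0 := (congrArg Prod.snd he).symm
    rcases hcond m hm with hc | hc
    · have := hf m.1
      rw [h1, Matrix.zero_vecMul, sub_zero] at this
      exact hc.2 ⟨_, subset_additiveLocus_of_offAxes_subset hC.irreducible hC0 this⟩
    · have := hg m.2
      rw [h2, Matrix.zero_vecMul, sub_zero] at this
      exact hc.2 ⟨_, this⟩
  have heval : ∀ u ∈ offAxesRationalPoints C,
      trigEval k l x (fun j => Ψ (integralLinear A (fun i => (u i : F)) j),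
        fun j => χ (integralMult B u j)) =
      h.evalTorus (fun i => Ψ (u i : F)) (fun i => χ (u i)) := by
    intro u hu
    simp only [x, map_sum, ContinuousMap.sum_apply, trigEval_single, evalTorus_eq_sum, Finsupp.sum]
    refine Finset.sum_congr rfl fun m _ => ?_
    rw [mul_assoc, ← Circle.coe_mul]
    congr 2
    simp only [monomialChar, ← AddChar.map_zsmul_eq_zpow, ← addChar_map_sum, ← map_zpow,
      ← map_prod, integralLinear_dotProduct]
    rw [prod_integralMult _ _ _ fun i a b => zpow_add _ a b, mul_mul_mul_comm,
      ← AddChar.map_add_eq_mul, ← map_mul]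
    have h1 : f m.1 = ∑ i, (m.1 - Matrix.vecMul (a m.1) A) i • (u i : F) := by
      apply (algebraMap F (AlgebraicClosure F)).injective
      rw [← hf m.1 (algebraMap_mem_offAxes hu)]
      simp
    have h2 : g m.2 = ∏ i, u i ^ (m.2 - Matrix.vecMul (b m.2) B) i := by
      apply Units.ext
      apply (algebraMap F (AlgebraicClosure F)).injective
      rw [algebraMap_prod_zpow, ← (hg m.2 (algebraMap_mem_offAxes hu)).2]
    congr 2
    · rw [h1, ← Finset.sum_add_distrib]
      exact Finset.sum_congr rfl fun i _ => by rw [← add_smul, Pi.sub_apply, sub_add_cancel]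
    · rw [h2, ← Finset.prod_mul_distrib]
      simp [← zpow_add]
  by_contra hneg
  rw [not_le] at hneg
  obtain ⟨c, hc, hc0⟩ := EReal.lt_iff_exists_real_btwn.1 hneg
  have hc0' : c < 0 := by exact_mod_cast hc0
  have hle : ∀ u ∈ offAxesRationalPoints C,
      (h.evalTorus (fun i => Ψ (u i : F)) (fun i => χ (u i))).re ≤ c := by
    intro u hu
    have := (le_iSup₂ (f := fun u (_ : u ∈ offAxesRationalPoints C) =>
      (((h.evalTorus (fun i => Ψ (u i : F)) (fun i => χ (u i))).re : ℝ) : EReal)) u hu).trans hc.le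
    exact_mod_cast this
  have hclosed : IsClosed {p | (trigEval k l x p).re ≤ c} :=
    isClosed_le (Complex.continuous_re.comp (trigEval k l x).continuous) continuous_const
  -- The bound is a closed condition, so it passes from the dense image to the whole torus.
  have hall : ∀ p, (trigEval k l x p).re ≤ c := fun p => by
    refine hclosed.closure_subset_iff.2 ?_ (hdense p)
    rintro _ ⟨_, ⟨u, hu, rfl⟩, rfl⟩
    have := hle u hu
    rw [← heval u hu] at this
    exact this
  obtain ⟨p, hp⟩ := exists_le_re_trigEval x hx0 (ε := -c) (by linarith)
  linarith [hall p]

end StarToAxiomFour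

end

end PFCharacters

theorem mainTheorem11 {F : Type*} [Field F] [CharZero F]
    (Ψ : AddChar F Circle) (χ : Fˣ →* Circle) :
    (PFCharacters.AxiomFour Ψ χ → PFCharacters.PropertyStar Ψ χ) ∧
    (PFCharacters.GaloisGroupIsZHat F →
      (PFCharacters.AxiomFour Ψ χ ↔ PFCharacters.PropertyStar Ψ χ)) :=
  ⟨fun h => h.propertyStar, fun _ => ⟨fun h => h.propertyStar, fun h => h.axiomFour⟩⟩
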